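/- **Lemma.** There is an absolute constant $C>0$ such that the following holds for all integers $n\ge 0$ and $M\ge 2$. Let $y_1,\dots,y_M$ be (fixed) vectors in $\mathbb R^n$ and let $\varepsilon_1,\dots,\varepsilon_M$ be independent random variables, each taking the values $1$ and $-1$ with probability $1/2$. Then $$ \mathbb E\,\Bigl\|\sum_{i=1}^M \varepsilon_i\, y_i\otimes y_i\Bigr\| \;\le\; C\,\sqrt{\log M}\;\cdot\;\max_{1\le i\le M}\|y_i\|\;\cdot\;\Bigl\|\sum_{i=1}^M y_i\otimes y_i\Bigr\|^{1/2} $$ (in particular, the expectation on the left exists and is finite). Here $y\otimes y$ is the linear operator $x\mapsto\langle x,y\rangle\,y$ on $\mathbb R^n$, $\|y_i\|$ is the Euclidean norm, the norm of an operator is its operator norm with respect to the Euclidean norm, and $\log$ is the natural logarithm. -/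

import Mathlib

open MeasureTheory ProbabilityTheory

noncomputable section

/-- The Rademacher (symmetric Bernoulli) distribution on `ℝ`: mass `1/2` at each of `1`, `-1`. -/
def rademacherLaw : Measure ℝ :=
  (2⁻¹ : ENNReal) • Measure.dirac (1 : ℝ) + (2⁻¹ : ENNReal) • Measure.dirac (-1 : ℝ)

/-- The operator `y ⊗ y` on `ℝⁿ`, that is `x ↦ ⟨y, x⟩ y`. Norms of such operators and of their
linear combinations are operator norms with respect to the Euclidean norm. -/
def selfTensor {n : ℕ} (y : EuclideanSpace ℝ (Fin n)) :
    EuclideanSpace ℝ (Fin n) →L[ℝ] EuclideanSpace ℝ (Fin n) :=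
  InnerProductSpace.rankOne ℝ y y

end

/-!
Rudelson's inequality for random signs, by comparing moments of traces.

For a sign vector `σ` let `S σ = ∑ i, σ i • y i ⊗ y i`, put `B = ‖∑ i, y i ⊗ y i‖`, and let `R`
bound the norms `‖y i‖`. Since `S σ` is self-adjoint, `‖S σ‖ ^ (2 * p) ≤ tr (S σ ^ (2 * p))`, so it is
enough to bound the average over all `σ` of these traces. The trace expands as
`tr (S ^ (2 * m + 2)) = ∑ i, σ i * ⟪y i, S ^ (2 * m + 1) y i⟫`.

The sum over `σ` of the `i`-th term is unchanged when `σ` is replaced by the vector with the `i`-th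
sign flipped. If `X` and `Y` denote the operators before and after the flip, then
`X - Y = 2 * σ i • y i ⊗ y i`, and telescoping `X ^ (2 * m + 1) - Y ^ (2 * m + 1)` leaves
`∑ q, ⟪y i, X ^ q y i⟫ * ⟪y i, Y ^ (2 * m - q) y i⟫`. In eigenbases of `X` and `Y` this is
controlled by the scalar inequality `a ^ q * b ^ r + a ^ r * b ^ q ≤ a ^ (q + r) + b ^ (q + r)`,
for `q + r` even. This gives `sum_sign_mul_inner_pow_le`. Combined with
`∑ i, ⟪y i, S ^ (2 * m) y i⟫ ≤ B * tr (S ^ (2 * m))` it yields a recursion in `m`, started by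
`∑ i, ‖y i‖ ^ 2 ≤ M * B` instead of by `tr 1`: the bound therefore sees the number `M` of vectors
and not the dimension. The outcome, `sum_trace_tensorSum_pow_le`, with `p = ⌈log M⌉` and Jensen's
inequality, is the claim for the uniform average over sign vectors, and `pi_rademacherLaw`
identifies the joint law of the random signs with that average.
-/

open scoped InnerProductSpace

/-! ### A scalar inequality -/

lemma pow_mul_pow_add_pow_mul_pow_le (a b : ℝ) {q r m : ℕ} (h : q + r = 2 * m) :
    a ^ q * b ^ r + a ^ r * b ^ q ≤ a ^ (2 * m) + b ^ (2 * m) := by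
  have key : 0 ≤ (|a| ^ q - |b| ^ q) * (|a| ^ r - |b| ^ r) := by
    rcases le_total |a| |b| with hab | hab
    · exact mul_nonneg_of_nonpos_of_nonpos
        (sub_nonpos.2 (pow_le_pow_left₀ (abs_nonneg a) hab q))
        (sub_nonpos.2 (pow_le_pow_left₀ (abs_nonneg a) hab r))
    · exact mul_nonneg (sub_nonneg.2 (pow_le_pow_left₀ (abs_nonneg b) hab q))
        (sub_nonneg.2 (pow_le_pow_left₀ (abs_nonneg b) hab r))
  have h1 : a ^ q * b ^ r ≤ |a| ^ q * |b| ^ r := by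
    simpa only [abs_mul, abs_pow] using le_abs_self (a ^ q * b ^ r)
  have h2 : a ^ r * b ^ q ≤ |a| ^ r * |b| ^ q := by
    simpa only [abs_mul, abs_pow] using le_abs_self (a ^ r * b ^ q)
  have ha : |a| ^ q * |a| ^ r = a ^ (2 * m) := by
    rw [← pow_add, h, (even_two_mul m).pow_abs]
  have hb : |b| ^ q * |b| ^ r = b ^ (2 * m) := by
    rw [← pow_add, h, (even_two_mul m).pow_abs]
  nlinarith

lemma sum_pow_mul_pow_le (a b : ℝ) (m : ℕ) :
    ∑ q ∈ Finset.range (2 * m + 1), a ^ q * b ^ (2 * m - q) ≤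
      (2 * m + 1) / 2 * (a ^ (2 * m) + b ^ (2 * m)) := by
  -- Pair each term with its mirror image under `q ↦ 2 * m - q`.
  have hr := Finset.sum_range_reflect (fun q => a ^ q * b ^ (2 * m - q)) (2 * m + 1)
  have hs : ∑ q ∈ Finset.range (2 * m + 1),
      (a ^ q * b ^ (2 * m - q) + a ^ (2 * m + 1 - 1 - q) * b ^ (2 * m - (2 * m + 1 - 1 - q))) ≤
      ∑ _q ∈ Finset.range (2 * m + 1), (a ^ (2 * m) + b ^ (2 * m)) := by
    refine Finset.sum_le_sum fun q hq => ?_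
    have hq' : q ≤ 2 * m := Nat.lt_succ_iff.1 (Finset.mem_range.1 hq)
    have h1 : 2 * m + 1 - 1 - q = 2 * m - q := by omega
    have h2 : 2 * m - (2 * m - q) = q := by omega
    rw [h1, h2]
    exact pow_mul_pow_add_pow_mul_pow_le a b (by omega)
  rw [Finset.sum_add_distrib, hr, Finset.sum_const, Finset.card_range, nsmul_eq_mul] at hs
  push_cast at hs
  linarith

/-! ### Powers of self-adjoint operators in an eigenbasis -/

section Operators

variable {E : Type*} [NormedAddCommGroup E] [InnerProductSpace ℝ E]

lemma LinearMap.IsSymmetric.continuousLinearMap_pow {X : E →L[ℝ] E}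
    (hX : (X : E →ₗ[ℝ] E).IsSymmetric) (k : ℕ) (x z : E) :
    ⟪(X ^ k) x, z⟫_ℝ = ⟪x, (X ^ k) z⟫_ℝ := by
  have := hX.pow k x z
  simpa only [← ContinuousLinearMap.toLinearMap_pow, ContinuousLinearMap.coe_coe] using this

lemma inner_pow_two_mul_apply {X : E →L[ℝ] E} (hX : (X : E →ₗ[ℝ] E).IsSymmetric)
    (m : ℕ) (x : E) : ⟪x, (X ^ (2 * m)) x⟫_ℝ = ‖(X ^ m) x‖ ^ 2 := by
  rw [two_mul, pow_add, mul_apply_eq_comp, ← hX.continuousLinearMap_pow,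
    real_inner_self_eq_norm_sq]

lemma inner_pow_apply_eq_sum {X : E →L[ℝ] E} (hX : (X : E →ₗ[ℝ] E).IsSymmetric)
    {κ : Type*} [Fintype κ] (b : OrthonormalBasis κ ℝ E) (l : κ → ℝ)
    (hb : ∀ q k, (X ^ q) (b k) = l k ^ q • b k) (q : ℕ) (x : E) :
    ⟪x, (X ^ q) x⟫_ℝ = ∑ k, l k ^ q * ⟪b k, x⟫_ℝ ^ 2 := by
  rw [← b.sum_inner_mul_inner]
  refine Finset.sum_congr rfl fun k _ => ?_
  rw [← hX.continuousLinearMap_pow, hb, real_inner_smul_left, real_inner_comm]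
  ring

lemma trace_pow_two_mul {X : E →L[ℝ] E} (hX : (X : E →ₗ[ℝ] E).IsSymmetric) {κ : Type*}
    [Fintype κ] (b : OrthonormalBasis κ ℝ E) (m : ℕ) :
    LinearMap.trace ℝ E (X ^ (2 * m) : E →L[ℝ] E) = ∑ k, ‖(X ^ m) (b k)‖ ^ 2 := by
  rw [LinearMap.trace_eq_sum_inner _ b]
  exact Finset.sum_congr rfl fun k _ => inner_pow_two_mul_apply hX m (b k)

variable [FiniteDimensional ℝ E]

lemma exists_orthonormalBasis_pow_apply {X : E →L[ℝ] E} (hX : (X : E →ₗ[ℝ] E).IsSymmetric) :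
    ∃ (b : OrthonormalBasis (Fin (Module.finrank ℝ E)) ℝ E)
      (l : Fin (Module.finrank ℝ E) → ℝ), ∀ q k, (X ^ q) (b k) = l k ^ q • b k := by
  refine ⟨hX.eigenvectorBasis rfl, hX.eigenvalues rfl, fun q k => ?_⟩
  induction q with
  | zero => simp
  | succ q ih =>
    have h := hX.apply_eigenvectorBasis rfl k
    rw [ContinuousLinearMap.coe_coe] at h
    rw [pow_succ, mul_apply_eq_comp, h]
    simp only [RCLike.ofReal_real_eq_id, id_eq, map_smul, ih, smul_smul]
    rw [pow_succ']

lemma sum_inner_pow_mul_inner_pow_le {X Y : E →L[ℝ] E} (hX : (X : E →ₗ[ℝ] E).IsSymmetric)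
    (hY : (Y : E →ₗ[ℝ] E).IsSymmetric) (m : ℕ) (x : E) :
    ∑ q ∈ Finset.range (2 * m + 1), ⟪x, (X ^ q) x⟫_ℝ * ⟪x, (Y ^ (2 * m - q)) x⟫_ℝ ≤
      (2 * m + 1) / 2 * ‖x‖ ^ 2 * (⟪x, (X ^ (2 * m)) x⟫_ℝ + ⟪x, (Y ^ (2 * m)) x⟫_ℝ) := by
  obtain ⟨b, l, hb⟩ := exists_orthonormalBasis_pow_apply hX
  obtain ⟨c, μ, hc⟩ := exists_orthonormalBasis_pow_apply hY
  have hb1 : ∑ k, ⟪b k, x⟫_ℝ ^ 2 = ‖x‖ ^ 2 := by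
    simpa using b.sum_sq_norm_inner_right x
  have hc1 : ∑ k, ⟪c k, x⟫_ℝ ^ 2 = ‖x‖ ^ 2 := by
    simpa using c.sum_sq_norm_inner_right x
  simp only [inner_pow_apply_eq_sum hX b l hb, inner_pow_apply_eq_sum hY c μ hc]
  calc
    _ = ∑ j, ∑ k, ⟪b j, x⟫_ℝ ^ 2 * ⟪c k, x⟫_ℝ ^ 2 *
        ∑ q ∈ Finset.range (2 * m + 1), l j ^ q * μ k ^ (2 * m - q) := by
      simp only [Finset.sum_mul_sum]
      simp only [Finset.mul_sum]
      rw [Finset.sum_comm]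
      refine Finset.sum_congr rfl fun j _ => ?_
      rw [Finset.sum_comm]
      refine Finset.sum_congr rfl fun k _ => Finset.sum_congr rfl fun q _ => ?_
      ring
    _ ≤ ∑ j, ∑ k, ⟪b j, x⟫_ℝ ^ 2 * ⟪c k, x⟫_ℝ ^ 2 *
        ((2 * m + 1) / 2 * (l j ^ (2 * m) + μ k ^ (2 * m))) :=
      Finset.sum_le_sum fun j _ => Finset.sum_le_sum fun k _ =>
        mul_le_mul_of_nonneg_left (sum_pow_mul_pow_le _ _ m) (by positivity)
    _ = (2 * m + 1) / 2 * ((∑ j, l j ^ (2 * m) * ⟪b j, x⟫_ℝ ^ 2) * (∑ k, ⟪c k, x⟫_ℝ ^ 2) +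
        (∑ j, ⟪b j, x⟫_ℝ ^ 2) * (∑ k, μ k ^ (2 * m) * ⟪c k, x⟫_ℝ ^ 2)) := by
      simp only [Finset.sum_mul_sum]
      simp only [← Finset.sum_add_distrib, Finset.mul_sum]
      refine Finset.sum_congr rfl fun j _ => Finset.sum_congr rfl fun k _ => ?_
      ring
    _ = _ := by
      rw [hb1, hc1]
      ring

lemma trace_pow_two_mul_nonneg {X : E →L[ℝ] E} (hX : (X : E →ₗ[ℝ] E).IsSymmetric) (m : ℕ) :
    0 ≤ LinearMap.trace ℝ E (X ^ (2 * m) : E →L[ℝ] E) := by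
  rw [trace_pow_two_mul hX (stdOrthonormalBasis ℝ E)]
  positivity

lemma norm_pow_two_mul_le_trace {X : E →L[ℝ] E} (hX : (X : E →ₗ[ℝ] E).IsSymmetric) {p : ℕ}
    (hp : p ≠ 0) : ‖X‖ ^ (2 * p) ≤ LinearMap.trace ℝ E (X ^ (2 * p) : E →L[ℝ] E) := by
  obtain ⟨b, l, hb⟩ := exists_orthonormalBasis_pow_apply hX
  set t := LinearMap.trace ℝ E (X ^ (2 * p) : E →L[ℝ] E) with ht
  have h0 : 0 ≤ t := trace_pow_two_mul_nonneg hX p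
  have hl : ∀ k, l k ^ (2 * p) ≤ t := fun k => by
    have hterm : ∀ j, ‖(X ^ p) (b j)‖ ^ 2 = l j ^ (2 * p) := fun j => by
      rw [hb, norm_smul, b.norm_eq_one, mul_one, Real.norm_eq_abs, sq_abs, ← pow_mul, mul_comm]
    rw [ht, trace_pow_two_mul hX b, ← hterm k]
    exact Finset.single_le_sum (f := fun j => ‖(X ^ p) (b j)‖ ^ 2)
      (fun j _ => by positivity) (Finset.mem_univ k)
  -- `r` is the `2p`-th root of the trace; it dominates every eigenvalue in absolute value.
  set r := t ^ (((2 * p : ℕ) : ℝ)⁻¹) with hr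
  have hr0 : 0 ≤ r := Real.rpow_nonneg h0 _
  have hrt : r ^ (2 * p) = t := Real.rpow_inv_natCast_pow h0 (by omega)
  have hlr : ∀ k, l k ^ 2 ≤ r ^ 2 := fun k => by
    rw [← pow_le_pow_iff_left₀ (by positivity) (by positivity) hp, ← pow_mul, ← pow_mul, hrt]
    exact hl k
  have hXr : ‖X‖ ≤ r := by
    refine X.opNorm_le_bound hr0 fun x => ?_
    rw [← sq_le_sq₀ (by positivity) (by positivity), mul_pow]
    have h1 := b.sum_sq_norm_inner_right (X x)
    have h2 := b.sum_sq_norm_inner_right x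
    rw [← h1, ← h2, Finset.mul_sum]
    refine Finset.sum_le_sum fun k _ => ?_
    have h3 : ⟪b k, X x⟫_ℝ = l k * ⟪b k, x⟫_ℝ := by
      have h4 := hX.continuousLinearMap_pow 1 (b k) x
      rw [hb, real_inner_smul_left] at h4
      simpa using h4.symm
    rw [h3, norm_mul, mul_pow, Real.norm_eq_abs, sq_abs]
    exact mul_le_mul_of_nonneg_right (hlr k) (by positivity)
  calc ‖X‖ ^ (2 * p) ≤ r ^ (2 * p) := pow_le_pow_left₀ (norm_nonneg _) hXr _
    _ = t := hrt

end Operators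

/-! ### Traces averaged over sign vectors -/

section Signs

/-- The real vector with entries `±1` given by an assignment of signs, a sign being a unit
of `ℤ`. -/
noncomputable def signVector {ι : Type*} (σ : ι → ℤˣ) (i : ι) : ℝ := ((σ i : ℤ) : ℝ)

lemma signVector_mul_self {ι : Type*} (σ : ι → ℤˣ) (i : ι) :
    signVector σ i * signVector σ i = 1 := by
  rw [signVector, ← Int.cast_mul, ← Units.val_mul, Int.units_mul_self, Units.val_one,
    Int.cast_one]

variable {ι E : Type*} [Fintype ι] [NormedAddCommGroup E] [InnerProductSpace ℝ E]

/-- The operator `∑ i, c i • y i ⊗ y i`, where `(y ⊗ y) x = ⟪y, x⟫ • y`. -/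
noncomputable def tensorSum (y : ι → E) (c : ι → ℝ) : E →L[ℝ] E :=
  ∑ i, c i • InnerProductSpace.rankOne ℝ (y i) (y i)

lemma tensorSum_apply (y : ι → E) (c : ι → ℝ) (x : E) :
    tensorSum y c x = ∑ i, (c i * ⟪y i, x⟫_ℝ) • y i := by
  simp [tensorSum, smul_smul]

lemma isSymmetric_tensorSum (y : ι → E) (c : ι → ℝ) :
    (tensorSum y c : E →ₗ[ℝ] E).IsSymmetric := by
  intro x z
  simp only [ContinuousLinearMap.coe_coe, tensorSum_apply, sum_inner, inner_sum,
    real_inner_smul_left, real_inner_smul_right]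
  refine Finset.sum_congr rfl fun i _ => ?_
  rw [real_inner_comm (y i) x]
  ring

lemma continuous_tensorSum (y : ι → E) : Continuous (tensorSum y) := by
  unfold tensorSum
  fun_prop

lemma sum_sq_inner_le (y : ι → E) (x : E) :
    ∑ i, ⟪y i, x⟫_ℝ ^ 2 ≤ ‖tensorSum y 1‖ * ‖x‖ ^ 2 := by
  have h : ∑ i, ⟪y i, x⟫_ℝ ^ 2 = ⟪tensorSum y 1 x, x⟫_ℝ := by
    rw [tensorSum_apply, sum_inner]
    refine Finset.sum_congr rfl fun i _ => ?_
    rw [real_inner_smul_left, Pi.one_apply]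
    ring
  rw [h]
  calc ⟪tensorSum y 1 x, x⟫_ℝ ≤ ‖tensorSum y 1 x‖ * ‖x‖ := real_inner_le_norm _ _
    _ ≤ ‖tensorSum y 1‖ * ‖x‖ * ‖x‖ := by gcongr; exact ContinuousLinearMap.le_opNorm _ _
    _ = _ := by ring

lemma norm_sq_le_norm_tensorSum (y : ι → E) (i : ι) : ‖y i‖ ^ 2 ≤ ‖tensorSum y 1‖ := by
  rcases eq_or_ne (y i) 0 with h | h
  · simp [h]
  · have h1 : ⟪y i, y i⟫_ℝ ^ 2 ≤ ∑ j, ⟪y j, y i⟫_ℝ ^ 2 :=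
      Finset.single_le_sum (f := fun j => ⟪y j, y i⟫_ℝ ^ 2) (fun j _ => sq_nonneg _)
        (Finset.mem_univ i)
    have h2 := h1.trans (sum_sq_inner_le y (y i))
    rw [real_inner_self_eq_norm_sq, sq (‖y i‖ ^ 2)] at h2
    exact le_of_mul_le_mul_right h2 (by positivity)

/-- Telescoping for two elements that need not commute. -/
lemma pow_sub_pow_eq_sum_mul_sub_mul {A : Type*} [Ring A] (X Y : A) (n : ℕ) :
    X ^ (n + 1) - Y ^ (n + 1) = ∑ q ∈ Finset.range (n + 1), X ^ q * (X - Y) * Y ^ (n - q) := by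
  have h := Finset.sum_range_sub (fun q => X ^ q * Y ^ (n + 1 - q)) (n + 1)
  simp only [Nat.sub_self, pow_zero, mul_one, one_mul, Nat.sub_zero] at h
  rw [← h]
  refine Finset.sum_congr rfl fun q hq => ?_
  have hq' : q ≤ n := Nat.lt_succ_iff.1 (Finset.mem_range.1 hq)
  rw [Nat.add_sub_add_right, Nat.succ_sub hq', pow_succ X, pow_succ' Y]
  noncomm_ring

lemma tensorSum_sub_tensorSum_flip [DecidableEq ι] (y : ι → E) (σ : ι → ℤˣ) (i : ι) :
    tensorSum y (signVector σ) - tensorSum y (signVector (Function.update σ i (-σ i))) =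
      (2 * signVector σ i) • InnerProductSpace.rankOne ℝ (y i) (y i) := by
  rw [tensorSum, tensorSum, ← Finset.sum_sub_distrib, Finset.sum_eq_single i]
  · rw [← sub_smul]
    congr 1
    simp only [signVector, Function.update_self, Units.val_neg, Int.cast_neg]
    ring
  · intro j _ hj
    simp [signVector, Function.update_of_ne hj]
  · simp

lemma sum_flip [DecidableEq ι] (i : ι) (h : (ι → ℤˣ) → ℝ) :
    ∑ σ, h (Function.update σ i (-σ i)) = ∑ σ, h σ := by
  have hinv : Function.Involutive fun σ : ι → ℤˣ => Function.update σ i (-σ i) := by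
    intro σ
    simp
  exact Equiv.sum_comp hinv.toPerm h

variable [FiniteDimensional ℝ E]

/-- The form that integration by parts takes for random signs: a factor `σ i` is traded for
lowering the exponent by one, at the price of `(2 * m + 1) * ‖y i‖ ^ 2`. -/
lemma sum_sign_mul_inner_pow_le [DecidableEq ι] (y : ι → E) (i : ι) (m : ℕ) :
    ∑ σ, signVector σ i * ⟪y i, (tensorSum y (signVector σ) ^ (2 * m + 1)) (y i)⟫_ℝ ≤
      (2 * m + 1) * ‖y i‖ ^ 2 *
        ∑ σ, ⟪y i, (tensorSum y (signVector σ) ^ (2 * m)) (y i)⟫_ℝ := by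
  set h : (ι → ℤˣ) → ℝ := fun σ =>
    signVector σ i * ⟪y i, (tensorSum y (signVector σ) ^ (2 * m + 1)) (y i)⟫_ℝ with hh
  set g : (ι → ℤˣ) → ℝ := fun σ =>
    ⟪y i, (tensorSum y (signVector σ) ^ (2 * m)) (y i)⟫_ℝ with hg
  have key : ∀ σ, h σ + h (Function.update σ i (-σ i)) ≤
      (2 * m + 1) * ‖y i‖ ^ 2 * (g σ + g (Function.update σ i (-σ i))) := fun σ => by
    set X := tensorSum y (signVector σ) with hX
    set Y := tensorSum y (signVector (Function.update σ i (-σ i))) with hY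
    have hflip : signVector (Function.update σ i (-σ i)) i = -signVector σ i := by
      simp [signVector]
    have hXY : ⟪y i, (X ^ (2 * m + 1)) (y i)⟫_ℝ - ⟪y i, (Y ^ (2 * m + 1)) (y i)⟫_ℝ =
        2 * signVector σ i * ∑ q ∈ Finset.range (2 * m + 1),
          ⟪y i, (X ^ q) (y i)⟫_ℝ * ⟪y i, (Y ^ (2 * m - q)) (y i)⟫_ℝ := by
      rw [← inner_sub_right, ← sub_apply, pow_sub_pow_eq_sum_mul_sub_mul,
        tensorSum_sub_tensorSum_flip, sum_apply, inner_sum, Finset.mul_sum]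
      refine Finset.sum_congr rfl fun q _ => ?_
      simp only [mul_apply_eq_comp, smul_apply,
        InnerProductSpace.rankOne_apply, map_smul, real_inner_smul_right]
      ring
    have hle := sum_inner_pow_mul_inner_pow_le (isSymmetric_tensorSum y (signVector σ))
      (isSymmetric_tensorSum y (signVector (Function.update σ i (-σ i)))) m (y i)
    calc h σ + h (Function.update σ i (-σ i))
        = signVector σ i * (⟪y i, (X ^ (2 * m + 1)) (y i)⟫_ℝ -
            ⟪y i, (Y ^ (2 * m + 1)) (y i)⟫_ℝ) := by
          simp only [hh, hflip, ← hX, ← hY]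
          ring
      _ = 2 * ∑ q ∈ Finset.range (2 * m + 1),
          ⟪y i, (X ^ q) (y i)⟫_ℝ * ⟪y i, (Y ^ (2 * m - q)) (y i)⟫_ℝ := by
          rw [hXY]
          linear_combination (2 * ∑ q ∈ Finset.range (2 * m + 1),
            ⟪y i, (X ^ q) (y i)⟫_ℝ * ⟪y i, (Y ^ (2 * m - q)) (y i)⟫_ℝ) * signVector_mul_self σ i
      _ ≤ _ := by
          simp only [hg, ← hX, ← hY]
          linarith
  have hsum := Finset.sum_le_sum fun σ (_ : σ ∈ Finset.univ) => key σ
  rw [← Finset.mul_sum, Finset.sum_add_distrib, Finset.sum_add_distrib, sum_flip i h,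
    sum_flip i g] at hsum
  linarith

lemma trace_tensorSum_pow_succ (y : ι → E) (c : ι → ℝ) (n : ℕ) :
    LinearMap.trace ℝ E (tensorSum y c ^ (n + 1) : E →L[ℝ] E) =
      ∑ i, c i * ⟪y i, (tensorSum y c ^ n) (y i)⟫_ℝ := by
  have h : tensorSum y c ^ (n + 1) =
      ∑ i, c i • InnerProductSpace.rankOne ℝ ((tensorSum y c ^ n) (y i)) (y i) := by
    rw [pow_succ]
    nth_rw 2 [tensorSum]
    rw [Finset.mul_sum]
    refine Finset.sum_congr rfl fun i _ => ?_
    rw [mul_smul_comm, ContinuousLinearMap.mul_def, InnerProductSpace.comp_rankOne]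
  rw [h]
  simp [InnerProductSpace.trace_rankOne]

lemma sum_inner_pow_le_norm_mul_trace (y : ι → E) {X : E →L[ℝ] E}
    (hX : (X : E →ₗ[ℝ] E).IsSymmetric) (m : ℕ) :
    ∑ i, ⟪y i, (X ^ (2 * m)) (y i)⟫_ℝ ≤
      ‖tensorSum y 1‖ * LinearMap.trace ℝ E (X ^ (2 * m) : E →L[ℝ] E) := by
  have b := stdOrthonormalBasis ℝ E
  calc ∑ i, ⟪y i, (X ^ (2 * m)) (y i)⟫_ℝ
      = ∑ i, ∑ k, ⟪y i, (X ^ m) (b k)⟫_ℝ ^ 2 := by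
        refine Finset.sum_congr rfl fun i _ => ?_
        rw [inner_pow_two_mul_apply hX, ← b.sum_sq_norm_inner_left]
        refine Finset.sum_congr rfl fun k _ => ?_
        rw [hX.continuousLinearMap_pow, Real.norm_eq_abs, sq_abs]
    _ = ∑ k, ∑ i, ⟪y i, (X ^ m) (b k)⟫_ℝ ^ 2 := Finset.sum_comm
    _ ≤ ∑ k, ‖tensorSum y 1‖ * ‖(X ^ m) (b k)‖ ^ 2 :=
        Finset.sum_le_sum fun k _ => sum_sq_inner_le y _
    _ = _ := by rw [← Finset.mul_sum, ← trace_pow_two_mul hX b]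

lemma sum_trace_tensorSum_pow_succ_le [DecidableEq ι] (y : ι → E) {R : ℝ}
    (hR : ∀ i, ‖y i‖ ≤ R) (m : ℕ) :
    ∑ σ, LinearMap.trace ℝ E (tensorSum y (signVector σ) ^ (2 * (m + 1)) : E →L[ℝ] E) ≤
      (2 * m + 1) * R ^ 2 *
        ∑ σ, ∑ i, ⟪y i, (tensorSum y (signVector σ) ^ (2 * m)) (y i)⟫_ℝ := by
  have h2 : 2 * (m + 1) = 2 * m + 1 + 1 := by ring
  simp only [h2, trace_tensorSum_pow_succ]
  rw [Finset.sum_comm, Finset.sum_comm (s := Finset.univ (α := ι → ℤˣ)), Finset.mul_sum]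
  refine Finset.sum_le_sum fun i _ => (sum_sign_mul_inner_pow_le y i m).trans ?_
  refine mul_le_mul_of_nonneg_right ?_ (Finset.sum_nonneg fun σ _ => ?_)
  · gcongr
    exact hR i
  · rw [inner_pow_two_mul_apply (isSymmetric_tensorSum y _)]
    positivity

/-- The trace moments over all sign vectors. The number `p` is fixed beforehand, and `2 * p` bounds
all the factors `2 * m + 1` that the recursion produces. -/
lemma sum_trace_tensorSum_pow_le [DecidableEq ι] (y : ι → E) {R : ℝ}
    (hR : ∀ i, ‖y i‖ ≤ R) (p m : ℕ) (hm : m + 1 ≤ p) :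
    ∑ σ, LinearMap.trace ℝ E (tensorSum y (signVector σ) ^ (2 * (m + 1)) : E →L[ℝ] E) ≤
      Fintype.card (ι → ℤˣ) * Fintype.card ι *
        (2 * p * R ^ 2 * ‖tensorSum y 1‖) ^ (m + 1) := by
  induction m with
  | zero =>
    have hp : (1 : ℝ) ≤ p := by exact_mod_cast hm
    refine (sum_trace_tensorSum_pow_succ_le y hR 0).trans ?_
    have h1 : ∑ i, ‖y i‖ ^ 2 ≤ Fintype.card ι * ‖tensorSum y 1‖ := by
      simpa using Finset.sum_le_sum fun i (_ : i ∈ Finset.univ) => norm_sq_le_norm_tensorSum y i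
    simp only [mul_zero, pow_zero, one_apply_eq_self, real_inner_self_eq_norm_sq,
      Finset.sum_const, Finset.card_univ, nsmul_eq_mul, Nat.cast_zero, zero_add, one_mul, pow_one]
    calc R ^ 2 * ((Fintype.card (ι → ℤˣ) : ℝ) * ∑ i, ‖y i‖ ^ 2)
        ≤ R ^ 2 * ((Fintype.card (ι → ℤˣ) : ℝ) * (Fintype.card ι * ‖tensorSum y 1‖)) := by
          gcongr
      _ = (Fintype.card (ι → ℤˣ) : ℝ) * Fintype.card ι * (1 * R ^ 2 * ‖tensorSum y 1‖) := by ring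
      _ ≤ _ := by
          gcongr
          linarith
  | succ m ih =>
    have hp : ((m + 1 : ℕ) : ℝ) + 1 ≤ p := by exact_mod_cast hm
    have ih' := ih (by omega)
    have h1 : ∑ σ, ∑ i, ⟪y i, (tensorSum y (signVector σ) ^ (2 * (m + 1))) (y i)⟫_ℝ ≤
        ‖tensorSum y 1‖ * ∑ σ, LinearMap.trace ℝ E
          (tensorSum y (signVector σ) ^ (2 * (m + 1)) : E →L[ℝ] E) := by
      rw [Finset.mul_sum]
      exact Finset.sum_le_sum fun σ _ =>
        sum_inner_pow_le_norm_mul_trace y (isSymmetric_tensorSum y _) (m + 1)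
    refine (sum_trace_tensorSum_pow_succ_le y hR (m + 1)).trans ?_
    calc (2 * ((m + 1 : ℕ) : ℝ) + 1) * R ^ 2 *
          ∑ σ, ∑ i, ⟪y i, (tensorSum y (signVector σ) ^ (2 * (m + 1))) (y i)⟫_ℝ
        ≤ (2 * ((m + 1 : ℕ) : ℝ) + 1) * R ^ 2 * (‖tensorSum y 1‖ *
          (Fintype.card (ι → ℤˣ) * Fintype.card ι *
            (2 * p * R ^ 2 * ‖tensorSum y 1‖) ^ (m + 1))) := by
          gcongr
          exact h1.trans (by gcongr)
      _ ≤ (2 * p) * R ^ 2 * (‖tensorSum y 1‖ * (Fintype.card (ι → ℤˣ) * Fintype.card ι *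
            (2 * p * R ^ 2 * ‖tensorSum y 1‖) ^ (m + 1))) := by
          gcongr
          linarith
      _ = _ := by ring

lemma avg_norm_tensorSum_pow_le [DecidableEq ι] (y : ι → E) {R : ℝ} (hR : ∀ i, ‖y i‖ ≤ R)
    {p : ℕ} (hp : p ≠ 0) :
    ((Fintype.card (ι → ℤˣ) : ℝ)⁻¹ * ∑ σ, ‖tensorSum y (signVector σ)‖) ^ (2 * p) ≤
      Fintype.card ι * (2 * p * R ^ 2 * ‖tensorSum y 1‖) ^ p := by
  obtain ⟨m, rfl⟩ := Nat.exists_eq_succ_of_ne_zero hp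
  have hN : (0 : ℝ) < Fintype.card (ι → ℤˣ) := by exact_mod_cast Fintype.card_pos
  have hJ := Real.pow_arith_mean_le_arith_mean_pow Finset.univ
    (fun _ : ι → ℤˣ => (Fintype.card (ι → ℤˣ) : ℝ)⁻¹)
    (fun σ => ‖tensorSum y (signVector σ)‖) (fun _ _ => by positivity)
    (by simp [Finset.sum_const, Finset.card_univ, -Fintype.card_pi]) (fun _ _ => norm_nonneg _)
    (2 * (m + 1))
  rw [← Finset.mul_sum, ← Finset.mul_sum] at hJ
  refine hJ.trans ?_
  rw [inv_mul_le_iff₀ hN, ← mul_assoc]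
  exact (Finset.sum_le_sum fun σ _ =>
    norm_pow_two_mul_le_trace (isSymmetric_tensorSum y _) hp).trans
    (sum_trace_tensorSum_pow_le y hR (m + 1) m le_rfl)

/-- The inequality for the uniform average over sign vectors. The `2p`-th moment with
`p = ⌈log M⌉` is used, so that the factor `M` contributes at most `exp p`. -/
lemma avg_norm_tensorSum_le [DecidableEq ι] (hM : 2 ≤ Fintype.card ι) (y : ι → E) {R : ℝ}
    (hR : ∀ i, ‖y i‖ ≤ R) :
    (Fintype.card (ι → ℤˣ) : ℝ)⁻¹ * ∑ σ, ‖tensorSum y (signVector σ)‖ ≤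
      4 * √(Real.log (Fintype.card ι)) * R * √‖tensorSum y 1‖ := by
  set M : ℝ := (Fintype.card ι : ℝ) with hMdef
  have hM2 : (2 : ℝ) ≤ M := by
    rw [hMdef]
    exact_mod_cast hM
  have hR0 : 0 ≤ R := by
    obtain ⟨i⟩ : Nonempty ι := Fintype.card_pos_iff.1 (by omega)
    exact (norm_nonneg _).trans (hR i)
  have hlog : Real.log 2 ≤ Real.log M := Real.log_le_log (by norm_num) hM2
  have hlog2 := Real.log_two_gt_d9
  set p := ⌈Real.log M⌉₊ with hpdef
  have hp : p ≠ 0 := (Nat.ceil_pos.2 (by linarith)).ne'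
  have hp1 : Real.log M ≤ p := Nat.le_ceil _
  have hp2 : (p : ℝ) < Real.log M + 1 := Nat.ceil_lt_add_one (by linarith)
  -- `16 log M ≥ 2 * exp 1 * p`, because `p < log M + 1 ≤ (1 + 1 / log 2) log M`.
  have hpe : Real.exp 1 * (2 * p) ≤ 16 * Real.log M := by
    have he := Real.exp_one_lt_d9
    calc Real.exp 1 * (2 * p) ≤ 2.7182818286 * (2 * p) := by gcongr
      _ ≤ 16 * Real.log M := by linarith
  have hMp : M ≤ Real.exp 1 ^ p := by
    rw [← Real.exp_nat_mul, mul_one]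
    exact (Real.log_le_iff_le_exp (by linarith)).1 hp1
  refine le_of_pow_le_pow_left₀ (n := 2 * p) (by omega) (by positivity) ?_
  refine (avg_norm_tensorSum_pow_le y hR hp).trans ?_
  calc M * (2 * p * R ^ 2 * ‖tensorSum y 1‖) ^ p
      ≤ Real.exp 1 ^ p * (2 * p * R ^ 2 * ‖tensorSum y 1‖) ^ p := by gcongr
    _ = (Real.exp 1 * (2 * p) * (R ^ 2 * ‖tensorSum y 1‖)) ^ p := by
        rw [← mul_pow]
        ring
    _ ≤ (16 * Real.log M * (R ^ 2 * ‖tensorSum y 1‖)) ^ p := by gcongr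
    _ = (4 * √(Real.log M) * R * √‖tensorSum y 1‖) ^ (2 * p) := by
        rw [pow_mul]
        congr 1
        rw [mul_pow, mul_pow, mul_pow, Real.sq_sqrt (by linarith), Real.sq_sqrt (norm_nonneg _)]
        ring

end Signs

/-! ### The joint law of independent random signs -/

instance : IsProbabilityMeasure rademacherLaw := by
  refine ⟨?_⟩
  simp [rademacherLaw, ENNReal.inv_two_add_inv_two]

lemma pi_rademacherLaw (ι : Type*) [Fintype ι] [DecidableEq ι] :
    Measure.pi (fun _ : ι => rademacherLaw) =
      ∑ σ : ι → ℤˣ, (Fintype.card (ι → ℤˣ) : ENNReal)⁻¹ • Measure.dirac (signVector σ) := by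
  refine Measure.pi_eq fun s hs => ?_
  have h1 : ∀ i, rademacherLaw (s i) =
      ∑ u : ℤˣ, 2⁻¹ * (s i).indicator (1 : ℝ → ENNReal) ((u : ℤ) : ℝ) := fun i => by
    have hne : (1 : ℤˣ) ≠ -1 := by decide
    rw [UnitsInt.univ, Finset.sum_pair hne]
    simp [rademacherLaw, Measure.dirac_apply' _ (hs i)]
  have hcard : (Fintype.card (ι → ℤˣ) : ENNReal)⁻¹ = ∏ _i : ι, (2⁻¹ : ENNReal) := by
    simp [ENNReal.inv_pow]
  simp only [h1]
  rw [Finset.prod_univ_sum, Fintype.piFinset_univ, Measure.coe_finsetSum, Finset.sum_apply]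
  refine Finset.sum_congr rfl fun σ _ => ?_
  rw [Finset.prod_mul_distrib, ← hcard, Measure.smul_apply, smul_eq_mul,
    Measure.dirac_apply' _ (MeasurableSet.univ_pi hs)]
  congr 1
  by_cases h : ∀ i, signVector σ i ∈ s i
  · rw [Set.indicator_of_mem (by simpa using h)]
    refine (Finset.prod_eq_one fun i _ => ?_).symm
    exact Set.indicator_of_mem (h i) _
  · rw [Set.indicator_of_notMem (by simpa using h)]
    obtain ⟨i, hi⟩ := not_forall.1 h
    exact (Finset.prod_eq_zero (Finset.mem_univ i) (Set.indicator_of_notMem hi _)).symm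

lemma integrable_and_integral_eq_avg {ι Ω : Type*} [Fintype ι] [DecidableEq ι]
    [MeasurableSpace Ω] {P : Measure Ω} [IsProbabilityMeasure P] {ε : ι → Ω → ℝ}
    (hlaw : ∀ i, HasLaw (ε i) rademacherLaw P) (hind : iIndepFun ε P) {F : (ι → ℝ) → ℝ}
    (hF : Continuous F) :
    Integrable (fun ω => F fun i => ε i ω) P ∧
      ∫ ω, F (fun i => ε i ω) ∂P =
        (Fintype.card (ι → ℤˣ) : ℝ)⁻¹ * ∑ σ : ι → ℤˣ, F (signVector σ) := by
  have hm : ∀ i, AEMeasurable (ε i) P := fun i => (hlaw i).aemeasurable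
  have hmap : P.map (fun ω i => ε i ω) =
      ∑ σ : ι → ℤˣ, (Fintype.card (ι → ℤˣ) : ENNReal)⁻¹ • Measure.dirac (signVector σ) := by
    rw [(iIndepFun_iff_map_fun_eq_pi_map hm).1 hind, ← pi_rademacherLaw]
    simp only [(hlaw _).map_eq]
  have hm' : AEMeasurable (fun ω i => ε i ω) P := aemeasurable_pi_lambda _ hm
  have hc : (Fintype.card (ι → ℤˣ) : ENNReal)⁻¹ ≠ ⊤ := by
    simp
  have hint : ∀ σ ∈ (Finset.univ : Finset (ι → ℤˣ)), Integrable F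
      ((Fintype.card (ι → ℤˣ) : ENNReal)⁻¹ • Measure.dirac (signVector σ)) := fun σ _ =>
    (integrable_dirac (by simp)).smul_measure hc
  constructor
  · refine Integrable.comp_aemeasurable (f := fun ω i => ε i ω) (g := F) ?_ hm'
    rw [hmap]
    exact integrable_finsetSum_measure.2 hint
  · rw [← integral_map (φ := fun ω i => ε i ω) hm' hF.aestronglyMeasurable, hmap,
      integral_finsetSum_measure hint, Finset.mul_sum]
    refine Finset.sum_congr rfl fun σ _ => ?_
    rw [integral_smul_measure, integral_dirac]
    simp

theorem mainTheorem2 :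
    ∃ C : ℝ, 0 < C ∧
      ∀ (n M : ℕ), 2 ≤ M →
      ∀ (y : Fin M → EuclideanSpace ℝ (Fin n))
        (Ω : Type*) [MeasurableSpace Ω] (P : Measure Ω) [IsProbabilityMeasure P]
        (ε : Fin M → Ω → ℝ),
        (∀ i, HasLaw (ε i) rademacherLaw P) →
        iIndepFun ε P →
        Integrable (fun ω => ‖∑ i, ε i ω • selfTensor (y i)‖) P ∧
        ∫ ω, ‖∑ i, ε i ω • selfTensor (y i)‖ ∂P ≤
          C * √(Real.log M) * (⨆ i, ‖y i‖) * √‖∑ i, selfTensor (y i)‖ := by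
  refine ⟨4, by norm_num, fun n M hM y Ω _ P _ ε hlaw hind => ?_⟩
  obtain ⟨h1, h2⟩ := integrable_and_integral_eq_avg hlaw hind
    (F := fun c => ‖tensorSum y c‖) (continuous_tensorSum y).norm
  refine ⟨h1, h2.trans_le ?_⟩
  have h3 := avg_norm_tensorSum_le (by simpa using hM) y
    (fun i => le_ciSup (Set.finite_range fun i => ‖y i‖).bddAbove i)
  simpa [tensorSum, selfTensor] using h3
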